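/- **Setting.** Let $\Gamma$ be a discrete abelian group, $B$ a unital $C^*$-algebra and $\beta:\Gamma\to\mathrm{Aut}(B)$ a homomorphism. Let $\ell^2(\Gamma,B)$ be the Hilbert $B$-module of all $\psi:\Gamma\to B$ such that $\sum_x\psi(x)^*\psi(x)$ converges in $B$, with $\langle\psi,\varphi\rangle=\sum_x\psi(x)^*\varphi(x)$ and $\|\psi\|=\|\langle\psi,\psi\rangle\|^{1/2}$, and let $\mathrm{End}_B(\ell^2(\Gamma,B))$ be the $C^*$-algebra of adjointable operators. Let $\Omega$ be a locally compact Hausdorff space on which $\Gamma$ acts by homeomorphisms, and let $\Gamma\hookrightarrow\Omega$ be an equivariant embedding (for the translation action of $\Gamma$ on itself) with open dense range; we regard $\Gamma$ as a subset of $\Omega$ and write $\partial\Omega=\Omega\setminus\Gamma$. Put $A=C_0(\Omega,B)$, which restriction to $\Gamma$ identifies with a $C^*$-subalgebra of $\ell^\infty(\Gamma,B)$ containing $C_0(\Gamma,B)$ and invariant under $(\alpha_gf)(x)=\beta_g(f(g^{-1}x))$. Represent $A$ and $\Gamma$ on $\ell^2(\Gamma,B)$ by the regular covariant representation $$(f\psi)(x)=\beta_x^{-1}(f(x))\,\psi(x),\qquad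 (S_g\psi)(x)=\psi(g^{-1}x),$$ so that $S_gf=\alpha_g(f)S_g$, and let $A\rtimes\Gamma\subset\mathrm{End}_B(\ell^2(\Gamma,B))$ be the norm closure of the set of finite sums $\sum_gS_gf_g$ with $f_g\in A$. (If $\beta$ is trivial, $f$ acts by pointwise multiplication.) Let $\omega\in\partial\Omega$, and let $\Xi=\overline{\{g^{-1}\cdot\omega: g\in\Gamma\}}$ be its quasi-orbit. Let $A_\Xi=\{f\in A: f|_\Xi=0\}$, let $A_\Xi\rtimes\Gamma$ be the closed ideal of $A\rtimes\Gamma$ formed by the norm limits of finite sums $\sum_g S_gf_g$ with $f_g\in A_\Xi$, and let $$q:A\rtimes\Gamma\to (A\rtimes\Gamma)/(A_\Xi\rtimes\Gamma)= C_0(\Xi,B)\rtimes\Gamma$$ be the quotient map. The spectrum $\sigma(q(T))$ is taken in the unitization of the quotient algebra. For $W\subset\Gamma$ let $\chi_W$ be the operator of multiplication by the indicator function of $W$. **Proposition.** Let $T\in A\rtimes\Gamma$ be normal, and let $\eta\in C_0(\sigma(T)\setminus\{0\})$ satisfy $\mathrm{supp}(\eta)\cap\sigma(q(T))=\emptyset$,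 where $\mathrm{supp}(\eta)$ is the closure of $\{\eta\neq0\}$ in $\sigma(T)\setminus\{0\}$. Then for every $\varepsilon>0$ there is an open set $\mathcal W\subset\Omega$ containing $\Xi$ such that $W=\mathcal W\cap\Gamma$ satisfies all of the following. 1. $\|\chi_W\,\eta(T)\|\le\varepsilon$ in $\mathrm{End}_B(\ell^2(\Gamma,B))$. 2. If $T=U$ is unitary, then $\|\chi_W\,U^n\,\eta(U)\psi\|\le\varepsilon\|\psi\|$ for all $n\in\mathbb Z$ and all $\psi\in\ell^2(\Gamma,B)$. 3. If $T=H$ is self-adjoint, then $\|\chi_W\,e^{-itH}\,\eta(H)\psi\|\le\varepsilon\|\psi\|$ for all $t\in\mathbb R$ and all $\psi\in\ell^2(\Gamma,B)$. -/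

import Mathlib

open scoped ZeroAtInfty ENNReal

namespace Interface

/-! ### The Hilbert C⋆-module `ℓ²(Γ, B)` -/

section FiniteSums

variable {Γ B : Type*} [CStarAlgebra B]

/-- The seminorm `‖∑_{x ∈ F} ψ(x)⋆ψ(x)‖^{1/2}` of the restriction of `ψ` to a finite set. -/
noncomputable def finNorm (F : Finset Γ) (ψ : Γ → B) : ℝ :=
  √‖∑ x ∈ F, star (ψ x) * ψ x‖

theorem finNorm_sq (F : Finset Γ) (ψ : Γ → B) :
    finNorm F ψ ^ 2 = ‖∑ x ∈ F, star (ψ x) * ψ x‖ :=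
  Real.sq_sqrt (norm_nonneg _)

theorem finNorm_nonneg (F : Finset Γ) (ψ : Γ → B) : 0 ≤ finNorm F ψ := Real.sqrt_nonneg _

theorem norm_finInner_le (F : Finset Γ) (ψ φ : Γ → B) :
    ‖∑ x ∈ F, star (ψ x) * φ x‖ ≤ finNorm F ψ * finNorm F φ := by
  let _ := CStarAlgebra.spectralOrder B
  have := CStarAlgebra.spectralOrderedRing B
  let e : (Γ → B) → WithCStarModule B ((i : F) → B) :=
    fun ψ => (WithCStarModule.equiv B ((i : F) → B)).symm (fun i => star (ψ i))
  have hi : ∀ ψ φ : Γ → B, inner B (e φ) (e ψ) = ∑ x ∈ F, star (ψ x) * φ x := by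
    intro ψ φ
    rw [WithCStarModule.pi_inner, ← Finset.sum_coe_sort F]
    refine Finset.sum_congr rfl fun i _ => ?_
    rw [WithCStarModule.inner_def]
    simp [e]
  have hn : ∀ ψ : Γ → B, ‖e ψ‖ = finNorm F ψ := by
    intro ψ
    rw [CStarModule.norm_eq_sqrt_norm_inner_self (A := B), hi, finNorm]
  have := CStarModule.norm_inner_le (A := B) _ (x := e φ) (y := e ψ)
  rw [hi, hn, hn] at this
  linarith

theorem finNorm_add_le (F : Finset Γ) (ψ φ : Γ → B) :
    finNorm F (ψ + φ) ≤ finNorm F ψ + finNorm F φ := by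
  have h : finNorm F (ψ + φ) ^ 2 ≤ (finNorm F ψ + finNorm F φ) ^ 2 := by
    have e : ∑ x ∈ F, star ((ψ + φ) x) * (ψ + φ) x
        = ∑ x ∈ F, star (ψ x) * ψ x + ∑ x ∈ F, star (ψ x) * φ x
          + (∑ x ∈ F, star (φ x) * ψ x + ∑ x ∈ F, star (φ x) * φ x) := by
      rw [← Finset.sum_add_distrib, ← Finset.sum_add_distrib, ← Finset.sum_add_distrib]
      refine Finset.sum_congr rfl fun x _ => ?_
      simp only [Pi.add_apply, star_add]
      noncomm_ring
    rw [finNorm_sq, e]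
    have h1 := norm_finInner_le F ψ φ
    have h2 := norm_finInner_le F φ ψ
    have h3 := finNorm_sq F ψ
    have h4 := finNorm_sq F φ
    refine (norm_add_le _ _).trans ?_
    have h5 := norm_add_le (∑ x ∈ F, star (ψ x) * ψ x) (∑ x ∈ F, star (ψ x) * φ x)
    have h6 := norm_add_le (∑ x ∈ F, star (φ x) * ψ x) (∑ x ∈ F, star (φ x) * φ x)
    nlinarith
  exact (sq_le_sq₀ (finNorm_nonneg _ _) (add_nonneg (finNorm_nonneg _ _) (finNorm_nonneg _ _))).1 h

theorem finNorm_neg (F : Finset Γ) (ψ : Γ → B) : finNorm F (-ψ) = finNorm F ψ := by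
  simp [finNorm]

theorem finNorm_smul (F : Finset Γ) (c : ℂ) (ψ : Γ → B) :
    finNorm F (c • ψ) = ‖c‖ * finNorm F ψ := by
  have e : ∑ x ∈ F, star ((c • ψ) x) * (c • ψ) x
      = (star c * c) • ∑ x ∈ F, star (ψ x) * ψ x := by
    rw [Finset.smul_sum]
    refine Finset.sum_congr rfl fun x _ => ?_
    simp [smul_smul, mul_comm]
  rw [finNorm, e, norm_smul, Real.sqrt_mul (norm_nonneg _), finNorm]
  congr 1
  rw [norm_mul, norm_star, Real.sqrt_mul_self (norm_nonneg _)]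

theorem norm_sum_le_of_le (F : Finset Γ) {a b : Γ → B} (C : ℝ)
    (h : ∀ x, ∃ y : B, a x = star (y * b x) * (y * b x) ∧ ‖y‖ ≤ C) (hC : 0 ≤ C) :
    √‖∑ x ∈ F, a x‖ ≤ C * finNorm F b := by
  let _ := CStarAlgebra.spectralOrder B
  have := CStarAlgebra.spectralOrderedRing B
  have hle : ∑ x ∈ F, a x ≤ (C ^ 2) • ∑ x ∈ F, star (b x) * b x := by
    rw [Finset.smul_sum]
    refine Finset.sum_le_sum fun x _ => ?_
    obtain ⟨y, hy, hyC⟩ := h x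
    have h1 : star (b x) * (star y * y) * b x ≤ ‖star y * y‖ • (star (b x) * b x) :=
      CStarAlgebra.star_left_conjugate_le_norm_smul
    have h2 : a x = star (b x) * (star y * y) * b x := by
      rw [hy, star_mul]; noncomm_ring
    rw [h2]
    refine h1.trans ?_
    refine smul_le_smul_of_nonneg_right ?_ (star_mul_self_nonneg _)
    rw [CStarRing.norm_star_mul_self]
    nlinarith [norm_nonneg y]
  have h0 : 0 ≤ ∑ x ∈ F, a x := Finset.sum_nonneg fun x _ => by
    obtain ⟨y, hy, -⟩ := h x
    rw [hy]; exact star_mul_self_nonneg _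
  have h3 := CStarAlgebra.norm_le_norm_of_nonneg_of_le h0 hle
  rw [norm_smul, Real.norm_of_nonneg (sq_nonneg C)] at h3
  calc √‖∑ x ∈ F, a x‖ ≤ √(C ^ 2 * ‖∑ x ∈ F, star (b x) * b x‖) := Real.sqrt_le_sqrt h3
    _ = C * finNorm F b := by rw [Real.sqrt_mul (sq_nonneg C), Real.sqrt_sq hC, finNorm]

theorem finNorm_mono {F G : Finset Γ} (h : F ⊆ G) (ψ : Γ → B) :
    finNorm F ψ ≤ finNorm G ψ := by
  let _ := CStarAlgebra.spectralOrder B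
  have := CStarAlgebra.spectralOrderedRing B
  refine Real.sqrt_le_sqrt (CStarAlgebra.norm_le_norm_of_nonneg_of_le
    (Finset.sum_nonneg fun x _ => star_mul_self_nonneg _) ?_)
  exact Finset.sum_le_sum_of_subset_of_nonneg h fun x _ _ => star_mul_self_nonneg _

theorem norm_apply_le_finNorm {F : Finset Γ} {x : Γ} (hx : x ∈ F) (ψ : Γ → B) :
    ‖ψ x‖ ≤ finNorm F ψ := by
  have h := finNorm_mono (Finset.singleton_subset_iff.2 hx) ψ
  rwa [finNorm, Finset.sum_singleton, CStarRing.norm_star_mul_self,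
    Real.sqrt_mul_self (norm_nonneg _)] at h

theorem summable_iff_finNorm (ψ : Γ → B) :
    (Summable fun x => star (ψ x) * ψ x) ↔
      ∀ ε > 0, ∃ s : Finset Γ, ∀ t : Finset Γ, Disjoint t s → finNorm t ψ < ε := by
  rw [summable_iff_vanishing_norm]
  constructor
  · intro h ε hε
    obtain ⟨s, hs⟩ := h (ε ^ 2) (by positivity)
    refine ⟨s, fun t ht => ?_⟩
    have := hs t ht
    rw [← finNorm_sq] at this
    exact lt_of_pow_lt_pow_left₀ 2 hε.le this
  · intro h ε hε
    obtain ⟨s, hs⟩ := h (√ε) (Real.sqrt_pos.2 hε)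
    refine ⟨s, fun t ht => ?_⟩
    rw [← finNorm_sq, ← Real.sq_sqrt hε.le]
    exact pow_lt_pow_left₀ (hs t ht) (finNorm_nonneg _ _) two_ne_zero

end FiniteSums

/-- The functions `ψ : Γ → B` such that `∑ₓ ψ(x)⋆ψ(x)` converges in `B`. -/
def squareSummable (Γ B : Type*) [CStarAlgebra B] : Submodule ℂ (Γ → B) where
  carrier := {ψ | Summable fun x => star (ψ x) * ψ x}
  zero_mem' := by
    simp only [Set.mem_ofPred_eq, Pi.zero_apply, mul_zero]
    exact summable_zero
  add_mem' := by
    intro ψ φ hψ hφ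
    simp only [Set.mem_ofPred_eq] at *
    rw [summable_iff_finNorm] at *
    intro ε hε
    classical
    obtain ⟨s, hs⟩ := hψ (ε / 2) (by positivity)
    obtain ⟨s', hs'⟩ := hφ (ε / 2) (by positivity)
    refine ⟨s ∪ s', fun t ht => ?_⟩
    rw [Finset.disjoint_union_right] at ht
    have := finNorm_add_le t ψ φ
    have := hs t ht.1
    have := hs' t ht.2
    linarith
  smul_mem' := by
    intro c ψ hψ
    have e : (fun x => star ((c • ψ) x) * (c • ψ) x)
        = fun x => (star c * c) • (star (ψ x) * ψ x) := by
      funext x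
      simp [smul_smul, mul_comm]
    simp only [Set.mem_ofPred_eq] at *
    rw [e]
    exact hψ.const_smul _

/-- The right Hilbert `B`-module `ℓ²(Γ, B)`. -/
def EllTwo (Γ B : Type*) [CStarAlgebra B] : Type _ := squareSummable Γ B

namespace EllTwo

variable {Γ B : Type*} [CStarAlgebra B]

noncomputable instance : AddCommGroup (EllTwo Γ B) :=
  inferInstanceAs (AddCommGroup (squareSummable Γ B))

noncomputable instance : Module ℂ (EllTwo Γ B) :=
  inferInstanceAs (Module ℂ (squareSummable Γ B))

instance : FunLike (EllTwo Γ B) Γ B where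
  coe ψ := ψ.1
  coe_injective _ _ h := Subtype.ext h

/-- The element of `ℓ²(Γ, B)` given by a function `ψ` with `∑ₓ ψ(x)⋆ψ(x)` convergent. -/
def ofSummable (ψ : Γ → B) (h : Summable fun x => star (ψ x) * ψ x) : EllTwo Γ B :=
  (⟨ψ, h⟩ : squareSummable Γ B)

@[simp] theorem ofSummable_apply (ψ : Γ → B) (h : Summable fun x => star (ψ x) * ψ x) (x : Γ) :
    ofSummable ψ h x = ψ x := rfl

theorem coe_ofSummable (ψ : Γ → B) (h : Summable fun x => star (ψ x) * ψ x) :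
    ⇑(ofSummable ψ h) = ψ := rfl

@[ext] theorem ext {ψ φ : EllTwo Γ B} (h : ∀ x, ψ x = φ x) : ψ = φ := DFunLike.ext _ _ h

theorem summable_self (ψ : EllTwo Γ B) : Summable fun x => star (ψ x) * ψ x := ψ.2

theorem coe_add (ψ φ : EllTwo Γ B) : ((ψ + φ : EllTwo Γ B) : Γ → B) = ⇑ψ + ⇑φ := rfl
theorem coe_smul (c : ℂ) (ψ : EllTwo Γ B) : ((c • ψ : EllTwo Γ B) : Γ → B) = c • ⇑ψ := rfl
theorem coe_neg (ψ : EllTwo Γ B) : ((-ψ : EllTwo Γ B) : Γ → B) = -⇑ψ := rfl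
theorem coe_sub (ψ φ : EllTwo Γ B) : ((ψ - φ : EllTwo Γ B) : Γ → B) = ⇑ψ - ⇑φ := rfl
theorem coe_zero : ((0 : EllTwo Γ B) : Γ → B) = 0 := rfl
@[simp] theorem add_apply (ψ φ : EllTwo Γ B) (x : Γ) : (ψ + φ) x = ψ x + φ x := rfl
@[simp] theorem smul_apply (c : ℂ) (ψ : EllTwo Γ B) (x : Γ) : (c • ψ) x = c • ψ x := rfl
@[simp] theorem neg_apply (ψ : EllTwo Γ B) (x : Γ) : (-ψ) x = -ψ x := rfl
@[simp] theorem sub_apply (ψ φ : EllTwo Γ B) (x : Γ) : (ψ - φ) x = ψ x - φ x := rfl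
@[simp] theorem zero_apply (x : Γ) : (0 : EllTwo Γ B) x = 0 := rfl

/-- The `B`-valued inner product `⟨ψ, φ⟩ = ∑ₓ ψ(x)⋆φ(x)`. -/
noncomputable def bInner (ψ φ : EllTwo Γ B) : B := ∑' x, star (ψ x) * φ x

theorem summable_inner (ψ φ : EllTwo Γ B) : Summable fun x => star (ψ x) * φ x := by
  rw [summable_iff_vanishing_norm]
  intro ε hε
  classical
  obtain ⟨s, hs⟩ := (summable_iff_finNorm ψ).1 (summable_self ψ) (√ε) (Real.sqrt_pos.2 hε)
  obtain ⟨s', hs'⟩ := (summable_iff_finNorm φ).1 (summable_self φ) (√ε) (Real.sqrt_pos.2 hε)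
  refine ⟨s ∪ s', fun t ht => ?_⟩
  rw [Finset.disjoint_union_right] at ht
  refine (norm_finInner_le t ψ φ).trans_lt ?_
  rw [← Real.mul_self_sqrt hε.le]
  exact mul_lt_mul'' (hs t ht.1) (hs' t ht.2) (finNorm_nonneg _ _) (finNorm_nonneg _ _)

/-- The norm `‖ψ‖ = ‖⟨ψ, ψ⟩‖^{1/2}`. -/
noncomputable instance : Norm (EllTwo Γ B) := ⟨fun ψ => √‖bInner ψ ψ‖⟩

theorem norm_def (ψ : EllTwo Γ B) : ‖ψ‖ = √‖bInner ψ ψ‖ := rfl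

theorem norm_sq (ψ : EllTwo Γ B) : ‖ψ‖ ^ 2 = ‖bInner ψ ψ‖ := Real.sq_sqrt (norm_nonneg _)

theorem tendsto_finNorm (ψ : EllTwo Γ B) :
    Filter.Tendsto (fun F => finNorm F ψ) Filter.atTop (nhds ‖ψ‖) :=
  (Real.continuous_sqrt.tendsto _).comp ((summable_self ψ).hasSum.norm)

theorem finNorm_le_norm (F : Finset Γ) (ψ : EllTwo Γ B) : finNorm F ψ ≤ ‖ψ‖ :=
  ge_of_tendsto (tendsto_finNorm ψ) ((Filter.eventually_ge_atTop F).mono fun _ h => finNorm_mono h _)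

theorem norm_le_of_finNorm_le {ψ : EllTwo Γ B} {C : ℝ} (h : ∀ F, finNorm F ψ ≤ C) : ‖ψ‖ ≤ C :=
  le_of_tendsto (tendsto_finNorm ψ) (Filter.Eventually.of_forall h)

theorem norm_apply_le (ψ : EllTwo Γ B) (x : Γ) : ‖ψ x‖ ≤ ‖ψ‖ :=
  (norm_apply_le_finNorm (Finset.mem_singleton_self x) ψ).trans (finNorm_le_norm _ ψ)

noncomputable instance : NormedAddCommGroup (EllTwo Γ B) :=
  NormedAddCommGroup.ofCore (𝕜 := ℂ)
    { norm_nonneg := fun ψ => Real.sqrt_nonneg _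
      norm_smul := fun c ψ => by
        refine tendsto_nhds_unique (tendsto_finNorm (c • ψ)) ?_
        have : (fun F => finNorm F (c • ψ : EllTwo Γ B)) = fun F => ‖c‖ * finNorm F ψ := by
          funext F
          rw [coe_smul, finNorm_smul]
        rw [this]
        exact (tendsto_finNorm ψ).const_mul _
      norm_triangle := fun ψ φ => by
        refine le_of_tendsto_of_tendsto' (tendsto_finNorm (ψ + φ))
          ((tendsto_finNorm ψ).add (tendsto_finNorm φ)) fun F => ?_
        rw [coe_add]
        exact finNorm_add_le F ψ φ
      norm_eq_zero_iff := fun ψ => by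
        constructor
        · intro h
          ext x
          have := norm_apply_le ψ x
          rw [h] at this
          simpa using this
        · rintro rfl
          simp [norm_def, bInner] }

noncomputable instance : NormedSpace ℂ (EllTwo Γ B) where
  norm_smul_le c ψ := by
    refine norm_le_of_finNorm_le fun F => ?_
    rw [coe_smul, finNorm_smul]
    exact mul_le_mul_of_nonneg_left (finNorm_le_norm F ψ) (norm_nonneg c)

theorem norm_bInner_le (ψ φ : EllTwo Γ B) : ‖bInner ψ φ‖ ≤ ‖ψ‖ * ‖φ‖ :=
  le_of_tendsto_of_tendsto' (summable_inner ψ φ).hasSum.norm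
    ((tendsto_finNorm ψ).mul (tendsto_finNorm φ)) fun F => norm_finInner_le F ψ φ

theorem bInner_add_right (ψ φ χ : EllTwo Γ B) :
    bInner ψ (φ + χ) = bInner ψ φ + bInner ψ χ := by
  simp only [bInner, add_apply, mul_add]
  exact (summable_inner ψ φ).tsum_add (summable_inner ψ χ)

theorem bInner_smul_right (c : ℂ) (ψ φ : EllTwo Γ B) :
    bInner ψ (c • φ) = c • bInner ψ φ := by
  simp only [bInner, smul_apply, mul_smul_comm]
  exact (summable_inner ψ φ).tsum_const_smul c

theorem star_bInner (ψ φ : EllTwo Γ B) : star (bInner ψ φ) = bInner φ ψ := by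
  simp only [bInner, tsum_star, star_mul, star_star]

theorem bInner_add_left (ψ φ χ : EllTwo Γ B) :
    bInner (ψ + φ) χ = bInner ψ χ + bInner φ χ := by
  rw [← star_bInner, bInner_add_right, star_add, star_bInner, star_bInner]

theorem bInner_smul_left (c : ℂ) (ψ φ : EllTwo Γ B) :
    bInner (c • ψ) φ = star c • bInner ψ φ := by
  rw [← star_bInner, bInner_smul_right, star_smul, star_bInner]

/-- The right action `(ψ · b)(x) = ψ(x) b` of `B` on `ℓ²(Γ, B)`. -/
instance : SMul Bᵐᵒᵖ (EllTwo Γ B) where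
  smul b ψ := ofSummable (fun x => ψ x * b.unop) <| by
    have e : (fun x => star (ψ x * b.unop) * (ψ x * b.unop))
        = fun x => star b.unop * (star (ψ x) * ψ x) * b.unop := by
      funext x
      rw [star_mul]
      noncomm_ring
    rw [e]
    exact ((summable_self ψ).mul_left _).mul_right _

@[simp] theorem op_smul_apply (b : Bᵐᵒᵖ) (ψ : EllTwo Γ B) (x : Γ) :
    (b • ψ) x = ψ x * b.unop := rfl

noncomputable instance : Module Bᵐᵒᵖ (EllTwo Γ B) where
  one_smul ψ := by ext x; simp
  mul_smul a b ψ := by ext x; simp [mul_assoc]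
  smul_zero a := by ext x; simp
  smul_add a ψ φ := by ext x; simp [add_mul]
  add_smul a b ψ := by ext x; simp [mul_add]
  zero_smul ψ := by ext x; simp

theorem bInner_op_smul_right (b : Bᵐᵒᵖ) (ψ φ : EllTwo Γ B) :
    bInner ψ (b • φ) = bInner ψ φ * b.unop := by
  simp only [bInner, op_smul_apply, ← mul_assoc]
  exact (summable_inner ψ φ).tsum_mul_right _

theorem bInner_sub_right (ψ φ χ : EllTwo Γ B) :
    bInner ψ (φ - χ) = bInner ψ φ - bInner ψ χ := by
  rw [eq_sub_iff_add_eq, ← bInner_add_right, sub_add_cancel]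

theorem bInner_sub_left (ψ φ χ : EllTwo Γ B) :
    bInner (ψ - φ) χ = bInner ψ χ - bInner φ χ := by
  rw [eq_sub_iff_add_eq, ← bInner_add_left, sub_add_cancel]

theorem bInner_self_eq_zero {ψ : EllTwo Γ B} (h : bInner ψ ψ = 0) : ψ = 0 := by
  rw [← norm_eq_zero, norm_def, h, norm_zero, Real.sqrt_zero]

theorem continuous_bInner : Continuous fun p : EllTwo Γ B × EllTwo Γ B => bInner p.1 p.2 := by
  rw [continuous_iff_continuousAt]
  rintro ⟨ψ, φ⟩
  rw [ContinuousAt, tendsto_iff_norm_sub_tendsto_zero]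
  have hb : ∀ p : EllTwo Γ B × EllTwo Γ B, ‖bInner p.1 p.2 - bInner ψ φ‖
      ≤ ‖p.1 - ψ‖ * ‖p.2‖ + ‖ψ‖ * ‖p.2 - φ‖ := by
    intro p
    have e : bInner p.1 p.2 - bInner ψ φ = bInner (p.1 - ψ) p.2 + bInner ψ (p.2 - φ) := by
      rw [bInner_sub_left, bInner_sub_right]; abel
    rw [e]
    exact (norm_add_le _ _).trans (add_le_add (norm_bInner_le _ _) (norm_bInner_le _ _))
  refine squeeze_zero (fun _ => norm_nonneg _) hb ?_
  have hc : Continuous fun p : EllTwo Γ B × EllTwo Γ B =>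
      ‖p.1 - ψ‖ * ‖p.2‖ + ‖ψ‖ * ‖p.2 - φ‖ := by fun_prop
  simpa using hc.tendsto (ψ, φ)

instance : CompleteSpace (EllTwo Γ B) := by
  refine Metric.complete_of_cauchySeq_tendsto fun u hu => ?_
  have hu' := Metric.cauchySeq_iff.1 hu
  have hpt : ∀ x, ∃ b, Filter.Tendsto (fun n => u n x) Filter.atTop (nhds b) := by
    intro x
    refine cauchySeq_tendsto_of_complete (Metric.cauchySeq_iff.2 fun ε hε => ?_)
    obtain ⟨N, hN⟩ := hu' ε hε
    refine ⟨N, fun m hm n hn => ?_⟩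
    have := hN m hm n hn
    rw [dist_eq_norm] at this ⊢
    exact (norm_apply_le (u m - u n) x).trans_lt this
  choose ψ hψ using hpt
  have key : ∀ ε > 0, ∃ N, ∀ n ≥ N, ∀ F : Finset Γ, finNorm F (⇑(u n) - ψ) ≤ ε := by
    intro ε hε
    obtain ⟨N, hN⟩ := hu' ε hε
    refine ⟨N, fun n hn F => ?_⟩
    have ht : Filter.Tendsto (fun m => finNorm F (⇑(u n) - ⇑(u m))) Filter.atTop
        (nhds (finNorm F (⇑(u n) - ψ))) := by
      refine (Real.continuous_sqrt.tendsto _).comp (Filter.Tendsto.norm ?_)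
      refine tendsto_finsetSum _ fun x _ => ?_
      have h1 : Filter.Tendsto (fun m => u n x - u m x) Filter.atTop (nhds (u n x - ψ x)) :=
        (hψ x).const_sub _
      exact h1.star.mul h1
    refine le_of_tendsto ht ((Filter.eventually_ge_atTop N).mono fun m hm => ?_)
    rw [← coe_sub]
    refine (finNorm_le_norm F _).trans ?_
    rw [← dist_eq_norm]
    exact (hN n hn m hm).le
  have hmem : Summable fun x => star (ψ x) * ψ x := by
    rw [summable_iff_finNorm]
    intro ε hε
    obtain ⟨N, hN⟩ := key (ε / 2) (by positivity)
    obtain ⟨s, hs⟩ := (summable_iff_finNorm (u N)).1 (summable_self (u N)) (ε / 2) (by positivity)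
    refine ⟨s, fun t ht => ?_⟩
    have e : ψ = ⇑(u N) + -(⇑(u N) - ψ) := by abel
    rw [e]
    refine (finNorm_add_le _ _ _).trans_lt ?_
    rw [finNorm_neg]
    have := hN N le_rfl t
    have := hs t ht
    linarith
  refine ⟨ofSummable ψ hmem, Metric.tendsto_atTop.2 fun ε hε => ?_⟩
  obtain ⟨N, hN⟩ := key (ε / 2) (by positivity)
  refine ⟨N, fun n hn => ?_⟩
  rw [dist_eq_norm]
  refine (norm_le_of_finNorm_le (C := ε / 2) fun F => ?_).trans_lt (by linarith)
  exact hN n hn F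

end EllTwo

/-! ### The C⋆-algebra `End_B(ℓ²(Γ, B))` of adjointable operators -/

open EllTwo

/-- The algebra `End_B(ℓ²(Γ, B))` of adjointable operators, with the operator norm. -/
def adjointable (Γ B : Type*) [CStarAlgebra B] :
    Subalgebra ℂ (EllTwo Γ B →L[ℂ] EllTwo Γ B) where
  carrier := {T | ∃ S : EllTwo Γ B →L[ℂ] EllTwo Γ B, ∀ ψ φ, bInner (T ψ) φ = bInner ψ (S φ)}
  mul_mem' := by
    rintro T T' ⟨S, hS⟩ ⟨S', hS'⟩
    exact ⟨S' * S, fun ψ φ => by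
      change bInner (T (T' ψ)) φ = bInner ψ (S' (S φ))
      rw [hS, hS']⟩
  add_mem' := by
    rintro T T' ⟨S, hS⟩ ⟨S', hS'⟩
    exact ⟨S + S', fun ψ φ => by
      change bInner (T ψ + T' ψ) φ = bInner ψ (S φ + S' φ)
      rw [bInner_add_left, bInner_add_right, hS, hS']⟩
  algebraMap_mem' c := ⟨star c • 1, fun ψ φ => by
    rw [Algebra.algebraMap_eq_smul_one]
    change bInner (c • ψ) φ = bInner ψ (star c • φ)
    rw [bInner_smul_left, bInner_smul_right]⟩

/-- `End_B(ℓ²(Γ, B))` as a type. -/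
def EndB (Γ B : Type*) [CStarAlgebra B] : Type _ := adjointable Γ B

namespace EndB

variable {Γ B : Type*} [CStarAlgebra B]

noncomputable instance : NormedRing (EndB Γ B) := inferInstanceAs (NormedRing (adjointable Γ B))

noncomputable instance : NormedAlgebra ℂ (EndB Γ B) :=
  inferInstanceAs (NormedAlgebra ℂ (adjointable Γ B))

/-- The underlying continuous linear map of an adjointable operator. -/
noncomputable def toCLM (T : EndB Γ B) : EllTwo Γ B →L[ℂ] EllTwo Γ B := Subtype.val (p := (· ∈ adjointable Γ B)) T

/-- An operator `T` with adjoint `S`, as an element of `End_B(ℓ²(Γ, B))`. -/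
noncomputable def ofAdjoint (T S : EllTwo Γ B →L[ℂ] EllTwo Γ B) (h : ∀ ψ φ, bInner (T ψ) φ = bInner ψ (S φ)) :
    EndB Γ B := (⟨T, S, h⟩ : adjointable Γ B)

noncomputable instance : FunLike (EndB Γ B) (EllTwo Γ B) (EllTwo Γ B) where
  coe T := T.toCLM
  coe_injective _ _ h := Subtype.ext (DFunLike.coe_injective h)

@[ext] theorem ext {T S : EndB Γ B} (h : ∀ ψ, T ψ = S ψ) : T = S := DFunLike.ext _ _ h

theorem toCLM_apply (T : EndB Γ B) (ψ : EllTwo Γ B) : T.toCLM ψ = T ψ := rfl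
@[simp] theorem ofAdjoint_apply (T S : EllTwo Γ B →L[ℂ] EllTwo Γ B)
    (h : ∀ ψ φ, bInner (T ψ) φ = bInner ψ (S φ)) (ψ : EllTwo Γ B) :
    ofAdjoint T S h ψ = T ψ := rfl
@[simp] theorem mul_apply (T S : EndB Γ B) (ψ : EllTwo Γ B) : (T * S) ψ = T (S ψ) := rfl
@[simp] theorem add_apply (T S : EndB Γ B) (ψ : EllTwo Γ B) : (T + S) ψ = T ψ + S ψ := rfl
@[simp] theorem sub_apply (T S : EndB Γ B) (ψ : EllTwo Γ B) : (T - S) ψ = T ψ - S ψ := rfl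
@[simp] theorem smul_apply (c : ℂ) (T : EndB Γ B) (ψ : EllTwo Γ B) : (c • T) ψ = c • T ψ := rfl
@[simp] theorem one_apply (ψ : EllTwo Γ B) : (1 : EndB Γ B) ψ = ψ := rfl
@[simp] theorem zero_apply (ψ : EllTwo Γ B) : (0 : EndB Γ B) ψ = 0 := rfl
theorem norm_def (T : EndB Γ B) : ‖T‖ = ‖T.toCLM‖ := rfl
theorem le_opNorm (T : EndB Γ B) (ψ : EllTwo Γ B) : ‖T ψ‖ ≤ ‖T‖ * ‖ψ‖ := T.toCLM.le_opNorm ψ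

theorem exists_adjoint (T : EndB Γ B) :
    ∃ S : EndB Γ B, ∀ ψ φ, bInner (T ψ) φ = bInner ψ (S φ) := by
  obtain ⟨S, hS⟩ := T.2
  refine ⟨ofAdjoint S T.toCLM fun ψ φ => ?_, hS⟩
  rw [← star_bInner, ← hS, star_bInner]
  rfl

/-- The involution sends an adjointable operator to its adjoint. -/
noncomputable instance : Star (EndB Γ B) := ⟨fun T => (exists_adjoint T).choose⟩

theorem bInner_star_right (T : EndB Γ B) (ψ φ : EllTwo Γ B) :
    bInner ψ (star T φ) = bInner (T ψ) φ := ((exists_adjoint T).choose_spec ψ φ).symm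

theorem bInner_star_left (T : EndB Γ B) (ψ φ : EllTwo Γ B) :
    bInner (star T ψ) φ = bInner ψ (T φ) := by
  rw [← star_bInner, bInner_star_right, star_bInner]

theorem star_eq_of {T S : EndB Γ B} (h : ∀ ψ φ, bInner (T ψ) φ = bInner ψ (S φ)) :
    star T = S := by
  ext1 φ
  rw [← sub_eq_zero]
  apply bInner_self_eq_zero
  rw [bInner_sub_right, bInner_star_right, h, sub_self]

noncomputable instance : StarRing (EndB Γ B) where
  star_involutive T := star_eq_of (bInner_star_left T)
  star_mul T S := star_eq_of fun ψ φ => by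
    simp only [mul_apply, bInner_star_right]
  star_add T S := star_eq_of fun ψ φ => by
    simp only [add_apply, bInner_add_left, bInner_add_right, bInner_star_right]

instance : StarModule ℂ (EndB Γ B) where
  star_smul c T := star_eq_of fun ψ φ => by
    simp only [smul_apply, bInner_smul_left, bInner_smul_right, bInner_star_right]

theorem norm_sq_le (T : EndB Γ B) : ‖T‖ * ‖T‖ ≤ ‖star T * T‖ := by
  have h : ‖T‖ ≤ √‖star T * T‖ := by
    refine ContinuousLinearMap.opNorm_le_bound _ (Real.sqrt_nonneg _) fun ψ => ?_
    change ‖T ψ‖ ≤ _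
    have h1 : ‖T ψ‖ ^ 2 ≤ ‖star T * T‖ * ‖ψ‖ ^ 2 := by
      have h2 := le_opNorm (star T * T) ψ
      rw [EllTwo.norm_sq, ← bInner_star_right]
      calc ‖bInner ψ ((star T * T) ψ)‖ ≤ ‖ψ‖ * ‖(star T * T) ψ‖ := norm_bInner_le _ _
        _ ≤ ‖ψ‖ * (‖star T * T‖ * ‖ψ‖) := by gcongr
        _ = ‖star T * T‖ * ‖ψ‖ ^ 2 := by ring
    calc ‖T ψ‖ = √(‖T ψ‖ ^ 2) := (Real.sqrt_sq (norm_nonneg _)).symm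
      _ ≤ √(‖star T * T‖ * ‖ψ‖ ^ 2) := Real.sqrt_le_sqrt h1
      _ = √‖star T * T‖ * ‖ψ‖ := by
        rw [Real.sqrt_mul' _ (sq_nonneg _), Real.sqrt_sq (norm_nonneg _)]
  calc ‖T‖ * ‖T‖ ≤ √‖star T * T‖ * √‖star T * T‖ :=
        mul_le_mul h h (norm_nonneg _) (Real.sqrt_nonneg _)
    _ = ‖star T * T‖ := Real.mul_self_sqrt (norm_nonneg _)

instance : CStarRing (EndB Γ B) where
  norm_mul_self_le := norm_sq_le

theorem isClosed_adjointable :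
    IsClosed (adjointable Γ B : Set (EllTwo Γ B →L[ℂ] EllTwo Γ B)) := by
  refine isClosed_of_closure_subset fun T hT => ?_
  obtain ⟨u, hu, hlim⟩ := mem_closure_iff_seq_limit.1 hT
  let v : ℕ → EndB Γ B := fun n => ⟨u n, hu n⟩
  have hcau : CauchySeq fun n => (star (v n)).toCLM := by
    have h := Metric.cauchySeq_iff.1 hlim.cauchySeq
    refine Metric.cauchySeq_iff.2 fun ε hε => ?_
    obtain ⟨N, hN⟩ := h ε hε
    refine ⟨N, fun m hm n hn => ?_⟩
    have h1 := hN m hm n hn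
    rw [dist_eq_norm] at h1 ⊢
    have h2 : ‖star (v m) - star (v n)‖ = ‖v m - v n‖ := by rw [← star_sub, norm_star]
    exact lt_of_eq_of_lt h2 h1
  obtain ⟨S, hS⟩ := cauchySeq_tendsto_of_complete hcau
  refine ⟨S, fun ψ φ => ?_⟩
  have h1 : Filter.Tendsto (fun n => bInner (u n ψ) φ) Filter.atTop (nhds (bInner (T ψ) φ)) :=
    (continuous_bInner.tendsto (T ψ, φ)).comp
      (((ContinuousLinearMap.apply ℂ _ ψ).continuous.tendsto T |>.comp hlim).prodMk_nhds
        tendsto_const_nhds)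
  have h2 : Filter.Tendsto (fun n => bInner ψ ((star (v n)).toCLM φ)) Filter.atTop
      (nhds (bInner ψ (S φ))) :=
    (continuous_bInner.tendsto (ψ, S φ)).comp
      (tendsto_const_nhds.prodMk_nhds
        ((ContinuousLinearMap.apply ℂ _ φ).continuous.tendsto S |>.comp hS))
  refine tendsto_nhds_unique h1 (h2.congr fun n => ?_)
  exact bInner_star_right (v n) ψ φ

instance : CompleteSpace (EndB Γ B) :=
  isClosed_adjointable.completeSpace_coe

noncomputable instance : CStarAlgebra (EndB Γ B) where

end EndB

/-! ### Multiplication operators and shifts -/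

section Operators

variable {Γ B : Type*} [CStarAlgebra B]

/-- Multiplication by `f ∈ ℓ^∞(Γ, B)` on `ℓ²(Γ, B)`, as a function. -/
def mulFun (f : lp (fun _ : Γ => B) ∞) (ψ : EllTwo Γ B) : EllTwo Γ B :=
  ofSummable (fun x => f x * ψ x) <| by
    rw [summable_iff_finNorm]
    intro ε hε
    have h := (summable_iff_finNorm ψ).1 (summable_self ψ)
    obtain ⟨s, hs⟩ := h (ε / (‖f‖ + 1)) (by positivity)
    refine ⟨s, fun t ht => ?_⟩
    have h1 : finNorm t (fun x => f x * ψ x) ≤ ‖f‖ * finNorm t ψ :=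
      norm_sum_le_of_le t ‖f‖
        (fun x => ⟨f x, rfl, lp.norm_apply_le_norm ENNReal.top_ne_zero f x⟩) (norm_nonneg f)
    have h2 := hs t ht
    rw [lt_div_iff₀ (by positivity)] at h2
    nlinarith [finNorm_nonneg t ψ]

@[simp] theorem mulFun_apply (f : lp (fun _ : Γ => B) ∞) (ψ : EllTwo Γ B) (x : Γ) :
    mulFun f ψ x = f x * ψ x := rfl

theorem norm_mulFun_le (f : lp (fun _ : Γ => B) ∞) (ψ : EllTwo Γ B) :
    ‖mulFun f ψ‖ ≤ ‖f‖ * ‖ψ‖ :=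
  norm_le_of_finNorm_le fun t =>
    (norm_sum_le_of_le t ‖f‖
      (fun x => ⟨f x, rfl, lp.norm_apply_le_norm ENNReal.top_ne_zero f x⟩) (norm_nonneg f)).trans
    (mul_le_mul_of_nonneg_left (finNorm_le_norm t ψ) (norm_nonneg f))

/-- Multiplication by `f ∈ ℓ^∞(Γ, B)` as a continuous linear map. -/
noncomputable def mulCLM (f : lp (fun _ : Γ => B) ∞) : EllTwo Γ B →L[ℂ] EllTwo Γ B :=
  LinearMap.mkContinuous
    { toFun := mulFun f
      map_add' := fun ψ φ => by ext x; simp [mul_add]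
      map_smul' := fun c ψ => by ext x; simp } ‖f‖ (norm_mulFun_le f)

@[simp] theorem mulCLM_apply (f : lp (fun _ : Γ => B) ∞) (ψ : EllTwo Γ B) (x : Γ) :
    mulCLM f ψ x = f x * ψ x := rfl

/-- The multiplication operator `(f · ψ)(x) = f(x) ψ(x)` in `End_B(ℓ²(Γ, B))`. -/
noncomputable def mulOp (f : lp (fun _ : Γ => B) ∞) : EndB Γ B :=
  EndB.ofAdjoint (mulCLM f) (mulCLM (star f)) fun ψ φ => by
    simp only [bInner, mulCLM_apply, star_mul, mul_assoc, lp.star_apply]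

@[simp] theorem mulOp_apply (f : lp (fun _ : Γ => B) ∞) (ψ : EllTwo Γ B) (x : Γ) :
    mulOp f ψ x = f x * ψ x := rfl

/-- The indicator function of `W ⊆ Γ`, as an element of `ℓ^∞(Γ, B)`. -/
noncomputable def indicatorFun (B : Type*) [CStarAlgebra B] (W : Set Γ) :
    lp (fun _ : Γ => B) ∞ :=
  ⟨W.indicator fun _ => (1 : B), memℓp_infty ⟨‖(1 : B)‖, by
    rintro _ ⟨x, rfl⟩
    exact norm_indicator_le_norm_self _ x⟩⟩

/-- The operator `χ_W` of multiplication by the indicator function of `W`. -/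
noncomputable def chi (B : Type*) [CStarAlgebra B] (W : Set Γ) : EndB Γ B :=
  mulOp (indicatorFun B W)

variable [CommGroup Γ]

/-- The translate `x ↦ ψ(g⁻¹x)`. -/
def shiftFun (g : Γ) (ψ : EllTwo Γ B) : EllTwo Γ B :=
  ofSummable (fun x => ψ (g⁻¹ * x)) <|
    (Equiv.mulLeft g⁻¹).summable_iff.2 (summable_self ψ)

@[simp] theorem shiftFun_apply (g : Γ) (ψ : EllTwo Γ B) (x : Γ) :
    shiftFun g ψ x = ψ (g⁻¹ * x) := rfl

theorem bInner_shiftFun (g : Γ) (ψ φ : EllTwo Γ B) :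
    bInner (shiftFun g ψ) φ = bInner ψ (shiftFun g⁻¹ φ) := by
  simp only [bInner, shiftFun_apply]
  rw [← (Equiv.mulLeft g).tsum_eq]
  simp

theorem norm_shiftFun (g : Γ) (ψ : EllTwo Γ B) : ‖shiftFun g ψ‖ = ‖ψ‖ := by
  have h : shiftFun g⁻¹ (shiftFun g ψ) = ψ := by ext x; simp
  rw [norm_def, bInner_shiftFun, h, ← norm_def]

/-- The translation by `g` as a continuous linear map. -/
noncomputable def shiftCLM (g : Γ) : EllTwo Γ B →L[ℂ] EllTwo Γ B :=
  LinearMap.mkContinuous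
    { toFun := shiftFun g
      map_add' := fun _ _ => rfl
      map_smul' := fun _ _ => rfl } 1 fun ψ => by
    rw [one_mul]; exact (norm_shiftFun g ψ).le

/-- The shift `(S_g ψ)(x) = ψ(g⁻¹x)` in `End_B(ℓ²(Γ, B))`. -/
noncomputable def shiftOp (B : Type*) [CStarAlgebra B] (g : Γ) : EndB Γ B :=
  EndB.ofAdjoint (shiftCLM g) (shiftCLM g⁻¹) fun ψ φ => bInner_shiftFun g ψ φ

@[simp] theorem shiftOp_apply (g : Γ) (ψ : EllTwo Γ B) (x : Γ) :
    shiftOp B g ψ x = ψ (g⁻¹ * x) := rfl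

end Operators

/-! ### Quotients of non-unital complex algebras -/

section Quotient

variable {R : Type*} [NonUnitalRing R] [Module ℂ R]

/-- A two-sided ideal that is a complex subspace. -/
class IsComplexIdeal (I : TwoSidedIdeal R) : Prop where
  smul_mem : ∀ (c : ℂ) (x : R), x ∈ I → c • x ∈ I

variable (I : TwoSidedIdeal R) [IsComplexIdeal I]

instance : SMul ℂ I.ringCon.Quotient where
  smul c := Quotient.map' (c • ·) fun x y h => by
    have h' : x - y ∈ I := (TwoSidedIdeal.rel_iff _ _ _).1 h
    refine (TwoSidedIdeal.rel_iff _ _ _).2 ?_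
    rw [← smul_sub]
    exact IsComplexIdeal.smul_mem c _ h'

noncomputable instance : Module ℂ I.ringCon.Quotient where
  one_smul := by
    rintro ⟨x⟩
    exact congrArg (Quotient.mk _) (one_smul ℂ x)
  mul_smul := by
    rintro a b ⟨x⟩
    exact congrArg (Quotient.mk _) (mul_smul a b x)
  smul_zero a := congrArg (Quotient.mk _) (smul_zero a)
  smul_add := by
    rintro a ⟨x⟩ ⟨y⟩
    exact congrArg (Quotient.mk _) (smul_add a x y)
  add_smul := by
    rintro a b ⟨x⟩
    exact congrArg (Quotient.mk _) (add_smul a b x)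
  zero_smul := by
    rintro ⟨x⟩
    exact congrArg (Quotient.mk _) (zero_smul ℂ x)

instance [IsScalarTower ℂ R R] : IsScalarTower ℂ I.ringCon.Quotient I.ringCon.Quotient where
  smul_assoc := by
    rintro c ⟨x⟩ ⟨y⟩
    exact congrArg (Quotient.mk _) (smul_mul_assoc c x y)

instance [SMulCommClass ℂ R R] : SMulCommClass ℂ I.ringCon.Quotient I.ringCon.Quotient where
  smul_comm := by
    rintro c ⟨x⟩ ⟨y⟩
    exact congrArg (Quotient.mk _) (mul_smul_comm c x y).symm

/-- The quotient homomorphism `R → R / I`. -/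
def quotientMap : R →ₙₐ[ℂ] I.ringCon.Quotient where
  toFun x := (x : I.ringCon.Quotient)
  map_smul' _ _ := rfl
  map_zero' := rfl
  map_add' _ _ := rfl
  map_mul' _ _ := rfl

end Quotient

/-! ### Crossed products -/

section CrossedProduct

variable {Γ B Ω : Type*} [CommGroup Γ] [CStarAlgebra B] (β : Γ →* (B ≃⋆ₐ[ℂ] B))
  [TopologicalSpace Ω] (ι : Γ → Ω)

/-- The bounded function `x ↦ β_x⁻¹(f(x))` on `Γ` attached to `f ∈ C₀(Ω, B)`. -/
noncomputable def twisted (f : C₀(Ω, B)) : lp (fun _ : Γ => B) ∞ :=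
  ⟨fun x => (β x).symm (f (ι x)), memℓp_infty ⟨‖f‖, by
    rintro _ ⟨x, rfl⟩
    refine (NonUnitalStarAlgHom.norm_apply_le _ _).trans ?_
    exact f.toBCF.norm_coe_le_norm (ι x)⟩⟩

@[simp] theorem twisted_apply (f : C₀(Ω, B)) (x : Γ) :
    twisted β ι f x = (β x).symm (f (ι x)) := rfl

/-- The representation of `A = C₀(Ω, B)` on `ℓ²(Γ, B)` that forms with the shifts the regular
covariant representation: `(f ψ)(x) = β_x⁻¹(f(x)) ψ(x)`. It is multiplication by `f|_Γ` if `β` is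
trivial. -/
noncomputable def funOp (f : C₀(Ω, B)) : EndB Γ B := mulOp (twisted β ι f)

theorem funOp_apply (f : C₀(Ω, B)) (ψ : EllTwo Γ B) (x : Γ) :
    funOp β ι f ψ x = (β x).symm (f (ι x)) * ψ x := rfl


/-- The generators `S_g f` with `g ∈ Γ` and `f ∈ I`. -/
def generators (I : Set C₀(Ω, B)) : Set (EndB Γ B) :=
  {T | ∃ g : Γ, ∃ f ∈ I, T = shiftOp B g * funOp β ι f}

variable {β ι}

theorem funOp_mul_funOp (f f' : C₀(Ω, B)) :
    funOp β ι f * funOp β ι f' = funOp β ι (f * f') := by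
  refine EndB.ext fun ψ => EllTwo.ext fun x => ?_
  change (β x).symm (f (ι x)) * ((β x).symm (f' (ι x)) * ψ x) = (β x).symm (f (ι x) * f' (ι x)) * ψ x
  rw [map_mul, mul_assoc]

theorem shiftOp_mul_shiftOp (g h : Γ) : shiftOp B g * shiftOp B h = shiftOp B (g * h) := by
  refine EndB.ext fun ψ => EllTwo.ext fun x => ?_
  change ψ (h⁻¹ * (g⁻¹ * x)) = ψ ((g * h)⁻¹ * x)
  rw [mul_inv_rev, mul_assoc]

theorem star_shiftOp (g : Γ) : star (shiftOp B g) = shiftOp B g⁻¹ :=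
  EndB.star_eq_of fun ψ φ => bInner_shiftFun g ψ φ

theorem star_funOp (f : C₀(Ω, B)) : star (funOp β ι f) = funOp β ι (star f) := by
  refine EndB.star_eq_of fun ψ φ => ?_
  change (∑' x, star ((β x).symm (f (ι x)) * ψ x) * φ x)
    = ∑' x, star (ψ x) * ((β x).symm (star (f (ι x))) * φ x)
  simp only [star_mul, mul_assoc, map_star]

variable [MulAction Γ Ω] [ContinuousConstSMul Γ Ω]

variable (β) in
/-- The action `(α_g f)(ω) = β_g(f(g⁻¹ω))` of `Γ` on `C₀(Ω, B)`. -/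
noncomputable def translate (g : Γ) (f : C₀(Ω, B)) : C₀(Ω, B) where
  toFun ω := β g (f (g⁻¹ • ω))
  continuous_toFun := by
    have h : Continuous (β g) := (NonUnitalStarAlgHom.isometry (β g) (β g).injective).continuous
    exact h.comp (f.continuous.comp (continuous_const_smul g⁻¹))
  zero_at_infty' := by
    have h : Continuous (β g) := (NonUnitalStarAlgHom.isometry (β g) (β g).injective).continuous
    have h0 := h.tendsto 0
    rw [map_zero] at h0
    exact h0.comp (f.zero_at_infty'.comp
      (Homeomorph.smul (g⁻¹ : Γ)).isClosedEmbedding.tendsto_cocompact)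

@[simp] theorem translate_apply (g : Γ) (f : C₀(Ω, B)) (ω : Ω) :
    translate β g f ω = β g (f (g⁻¹ • ω)) := rfl

theorem funOp_mul_shiftOp (hι : ∀ g x : Γ, ι (g * x) = g • ι x) (f : C₀(Ω, B)) (g : Γ) :
    funOp β ι f * shiftOp B g = shiftOp B g * funOp β ι (translate β g⁻¹ f) := by
  refine EndB.ext fun ψ => EllTwo.ext fun x => ?_
  change (β x).symm (f (ι x)) * ψ (g⁻¹ * x)
    = (β (g⁻¹ * x)).symm (β g⁻¹ (f ((g⁻¹)⁻¹ • ι (g⁻¹ * x)))) * ψ (g⁻¹ * x)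
  rw [hι, smul_smul, inv_inv, mul_inv_cancel, one_smul]
  congr 1
  symm
  rw [StarAlgEquiv.symm_apply_eq, map_mul, StarAlgEquiv.mul_apply, StarAlgEquiv.apply_symm_apply]

theorem shift_fun_mul (hι : ∀ g x : Γ, ι (g * x) = g • ι x) (g h : Γ) (f f' : C₀(Ω, B)) :
    shiftOp B g * funOp β ι f * (shiftOp B h * funOp β ι f')
      = shiftOp B (g * h) * funOp β ι (translate β h⁻¹ f * f') := by
  rw [mul_assoc, ← mul_assoc (funOp β ι f), funOp_mul_shiftOp hι, mul_assoc, funOp_mul_funOp,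
    ← mul_assoc, shiftOp_mul_shiftOp]

/-- The quasi-orbit `Ξ_ω`, the closure of `{g⁻¹ω | g ∈ Γ}`. -/
def quasiOrbit (Γ : Type*) {Ω : Type*} [CommGroup Γ] [TopologicalSpace Ω] [MulAction Γ Ω]
    (ω : Ω) : Set Ω :=
  closure (Set.range fun g : Γ => g⁻¹ • ω)

theorem smul_mem_quasiOrbit {ω ξ : Ω} (hξ : ξ ∈ quasiOrbit Γ ω) (g : Γ) :
    g • ξ ∈ quasiOrbit Γ ω := by
  refine map_mem_closure (continuous_const_smul g) hξ ?_
  rintro _ ⟨h, rfl⟩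
  exact ⟨h * g⁻¹, by simp [smul_smul]⟩

variable (β ι)

/-- The crossed product `A ⋊ Γ` with `A = C₀(Ω, B)`, as a C⋆-subalgebra of `End_B(ℓ²(Γ, B))`:
the norm closure of the finite sums `∑_g S_g f_g` with `f_g ∈ A`. -/
noncomputable def crossedProduct (hι : ∀ g x : Γ, ι (g * x) = g • ι x) :
    NonUnitalStarSubalgebra ℂ (EndB Γ B) :=
  NonUnitalStarSubalgebra.topologicalClosure
    { Submodule.span ℂ (generators β ι Set.univ) with
      mul_mem' := by
        intro T S hT hS
        change T * S ∈ Submodule.span ℂ (generators β ι Set.univ)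
        induction hT, hS using Submodule.span_induction₂ with
        | mem_mem T S hT hS =>
          obtain ⟨g, f, -, rfl⟩ := hT
          obtain ⟨h, f', -, rfl⟩ := hS
          exact Submodule.subset_span ⟨g * h, _, trivial, shift_fun_mul hι g h f f'⟩
        | zero_left S hS => simp
        | zero_right T hT => simp
        | add_left T T' S _ _ _ h1 h2 => rw [add_mul]; exact add_mem h1 h2
        | add_right T S S' _ _ _ h1 h2 => rw [mul_add]; exact add_mem h1 h2
        | smul_left c T S _ _ h => rw [smul_mul_assoc]; exact Submodule.smul_mem _ c h
        | smul_right c T S _ _ h => rw [mul_smul_comm]; exact Submodule.smul_mem _ c h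
      star_mem' := by
        intro T hT
        change star T ∈ Submodule.span ℂ (generators β ι Set.univ)
        induction hT using Submodule.span_induction with
        | mem T hT =>
          obtain ⟨g, f, -, rfl⟩ := hT
          rw [star_mul, star_shiftOp, star_funOp, funOp_mul_shiftOp hι]
          exact Submodule.subset_span ⟨g⁻¹, _, trivial, rfl⟩
        | zero => simp
        | add T S _ _ h1 h2 => rw [star_add]; exact add_mem h1 h2
        | smul c T _ h => rw [star_smul]; exact Submodule.smul_mem _ _ h }

/-- The ideal `{f ∈ C₀(Ω, B) | f|_Ξ = 0}` of `A`, where `Ξ` is the quasi-orbit of `ω`. -/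
def vanishingOn (Γ B : Type*) {Ω : Type*} [CommGroup Γ] [CStarAlgebra B] [TopologicalSpace Ω]
    [MulAction Γ Ω] (ω : Ω) : Set C₀(Ω, B) :=
  {f | ∀ ξ ∈ quasiOrbit Γ ω, f ξ = 0}

/-- The norm closure of the finite sums `∑_g S_g f_g` with `f_g|_Ξ = 0`. -/
noncomputable def idealSpace (ω : Ω) : Submodule ℂ (EndB Γ B) :=
  (Submodule.span ℂ (generators β ι (vanishingOn Γ B ω))).topologicalClosure

variable {β ι}

theorem mul_mem_idealSpace (hι : ∀ g x : Γ, ι (g * x) = g • ι x) {ω : Ω} {T S : EndB Γ B}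
    (hT : T ∈ crossedProduct β ι hι) (hS : S ∈ idealSpace β ι ω) : T * S ∈ idealSpace β ι ω := by
  refine map_mem_closure₂ continuous_mul hT hS fun T hT S hS => ?_
  change T ∈ Submodule.span ℂ (generators β ι Set.univ) at hT
  change S ∈ Submodule.span ℂ (generators β ι (vanishingOn Γ B ω)) at hS
  change T * S ∈ Submodule.span ℂ (generators β ι (vanishingOn Γ B ω))
  induction hT, hS using Submodule.span_induction₂ with
  | mem_mem T S hT hS =>
    obtain ⟨g, f, -, rfl⟩ := hT
    obtain ⟨h, f', hf', rfl⟩ := hS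
    refine Submodule.subset_span ⟨g * h, _, fun ξ hξ => ?_, shift_fun_mul hι g h f f'⟩
    rw [ZeroAtInftyContinuousMap.mul_apply, hf' ξ hξ, mul_zero]
  | zero_left S hS => simp
  | zero_right T hT => simp
  | add_left T T' S _ _ _ h1 h2 => rw [add_mul]; exact add_mem h1 h2
  | add_right T S S' _ _ _ h1 h2 => rw [mul_add]; exact add_mem h1 h2
  | smul_left c T S _ _ h => rw [smul_mul_assoc]; exact Submodule.smul_mem _ c h
  | smul_right c T S _ _ h => rw [mul_smul_comm]; exact Submodule.smul_mem _ c h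

theorem idealSpace_mul_mem (hι : ∀ g x : Γ, ι (g * x) = g • ι x) {ω : Ω} {T S : EndB Γ B}
    (hT : T ∈ idealSpace β ι ω) (hS : S ∈ crossedProduct β ι hι) : T * S ∈ idealSpace β ι ω := by
  refine map_mem_closure₂ continuous_mul hT hS fun T hT S hS => ?_
  change T ∈ Submodule.span ℂ (generators β ι (vanishingOn Γ B ω)) at hT
  change S ∈ Submodule.span ℂ (generators β ι Set.univ) at hS
  change T * S ∈ Submodule.span ℂ (generators β ι (vanishingOn Γ B ω))
  induction hT, hS using Submodule.span_induction₂ with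
  | mem_mem T S hT hS =>
    obtain ⟨g, f, hf, rfl⟩ := hT
    obtain ⟨h, f', -, rfl⟩ := hS
    refine Submodule.subset_span ⟨g * h, _, fun ξ hξ => ?_, shift_fun_mul hι g h f f'⟩
    rw [ZeroAtInftyContinuousMap.mul_apply, translate_apply,
      hf _ (smul_mem_quasiOrbit hξ _), map_zero, zero_mul]
  | zero_left S hS => simp
  | zero_right T hT => simp
  | add_left T T' S _ _ _ h1 h2 => rw [add_mul]; exact add_mem h1 h2
  | add_right T S S' _ _ _ h1 h2 => rw [mul_add]; exact add_mem h1 h2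
  | smul_left c T S _ _ h => rw [smul_mul_assoc]; exact Submodule.smul_mem _ c h
  | smul_right c T S _ _ h => rw [mul_smul_comm]; exact Submodule.smul_mem _ c h

variable (β)

/-- The closed two-sided ideal `A_Ξ ⋊ Γ` of `A ⋊ Γ`, where `A_Ξ = {f ∈ A | f|_Ξ = 0}` and `Ξ` is
the quasi-orbit of `ω`. -/
noncomputable def bulkIdeal (hι : ∀ g x : Γ, ι (g * x) = g • ι x) (ω : Ω) :
    TwoSidedIdeal (crossedProduct β ι hι) :=
  TwoSidedIdeal.mk' {T | (T : EndB Γ B) ∈ idealSpace β ι ω}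
    (zero_mem (idealSpace β ι ω)) (fun hx hy => (idealSpace β ι ω).add_mem hx hy)
    (fun hx => (idealSpace β ι ω).neg_mem hx)
    (fun {x _} hy => mul_mem_idealSpace hι x.2 hy) (fun {_ y} hx => idealSpace_mul_mem hι hx y.2)

theorem mem_bulkIdeal (hι : ∀ g x : Γ, ι (g * x) = g • ι x) (ω : Ω)
    (T : crossedProduct β ι hι) :
    T ∈ bulkIdeal β hι ω ↔ (T : EndB Γ B) ∈ idealSpace β ι ω :=
  TwoSidedIdeal.mem_mk' ..

/-- The bulk algebra `C₀(Ξ, B) ⋊ Γ = (A ⋊ Γ) / (A_Ξ ⋊ Γ)` of the quasi-orbit `Ξ` of `ω`. -/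
abbrev BulkAlgebra (hι : ∀ g x : Γ, ι (g * x) = g • ι x) (ω : Ω) : Type _ :=
  (bulkIdeal β hι ω).ringCon.Quotient

instance (hι : ∀ g x : Γ, ι (g * x) = g • ι x) (ω : Ω) : IsComplexIdeal (bulkIdeal β hι ω) where
  smul_mem c x h := by
    rw [mem_bulkIdeal] at h ⊢
    exact Submodule.smul_mem _ c h

/-- The quotient homomorphism `q : A ⋊ Γ → C₀(Ξ, B) ⋊ Γ` for the quasi-orbit `Ξ` of `ω`. -/
noncomputable def bulkMap (hι : ∀ g x : Γ, ι (g * x) = g • ι x) (ω : Ω) :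
    crossedProduct β ι hι →ₙₐ[ℂ] BulkAlgebra β hι ω :=
  quotientMap (bulkIdeal β hι ω)

end CrossedProduct

/-! ### Functions of a normal operator -/

/-- The operator `η(T)` for `T ∈ End_B(ℓ²(Γ, B))` normal and `η ∈ C₀(σ(T) ∖ {0})`: the continuous
functional calculus of `T` at the extension of `η` by zero. -/
noncomputable def evalAt {Γ B : Type*} [CStarAlgebra B] (T : EndB Γ B)
    (η : C₀(↥(spectrum ℂ T \ {0}), ℂ)) : EndB Γ B :=
  cfc (Function.extend Subtype.val η 0) T

end Interface

open Interface

/-! Write `I` for the closed subspace `idealSpace β ι ω`, that is `A_Ξ ⋊ Γ`. The proof has two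
halves: `η(T)` lies in `I`, and every element of `I` becomes small in norm once cut off to a
suitable neighbourhood of `Ξ`.

Morally `q(η(T)) = η(q(T)) = 0`. The proof of `evalAt_mem_idealSpace` needs no functional calculus
in the quotient, only its algebraic structure. The functions `f` on `σ(T)` with `f(T) ∈ I` form a
closed ideal of `C(σ(T))`, and such an ideal contains every function that vanishes on its common
zeros. So it suffices to find, for each `z` with `η(z) ≠ 0`, a member of the ideal not vanishing at
`z`. As `z ≠ 0` is not in the spectrum of `q(T)`, `1 - z⁻¹T` has a right inverse modulo `I`. On
functions supported near `z`, `1 - z⁻¹T` is small, so a bump `b = p(T)` at `z` satisfies `b ≡ bc`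
modulo `I` with `‖c‖ < 1`. Iterating, `b ≡ bcⁿ → 0`, hence `b ∈ I` (`mem_of_sub_mul_mem`,
`exists_mem_cfcIdeal_ne_zero`).

For the second half (`exists_isOpen_norm_chi_mul_le`), a generator `S_g f` with `f|_Ξ = 0` is small
where `‖f(g⁻¹x)‖` is small, and this open set contains `Ξ` because `Ξ` is invariant. Finite sums and
norm limits follow, since cut-offs are contractions.

The dynamical statements cost nothing more: `Uⁿ` and `e^{-itH}` are unitaries commuting with `η(T)`,
so one neighbourhood serves all times (`norm_mul_mul_apply_le`). -/

namespace Interface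

open Topology Filter

/-! ### Functional calculus modulo a closed subspace -/

section FunctionalCalculus

variable {A : Type*} [CStarAlgebra A] {T : A} {I : Submodule ℂ A}

/-- A closed subspace invariant under left multiplication by a normal element and its adjoint is
invariant under left multiplication by every continuous function of that element. -/
theorem cfcHom_mul_mem (hT : IsStarNormal T) (hI : IsClosed (I : Set A))
    (h1 : ∀ x ∈ I, T * x ∈ I) (h2 : ∀ x ∈ I, star T * x ∈ I) (f : C(spectrum ℂ T, ℂ)) :
    ∀ x ∈ I, cfcHom (R := ℂ) hT f * x ∈ I := by
  -- Stone–Weierstrass: polynomials in `z` and its conjugate are dense. The vector `x` stays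
  -- universally quantified because the product case feeds `g(T)x` to the hypothesis on `f`.
  induction f using ContinuousMap.induction_on_of_compact with
  | const r =>
    intro x hx
    have e : cfcHom (R := ℂ) hT (ContinuousMap.const _ r) = algebraMap ℂ A r :=
      AlgHomClass.commutes (cfcHom (R := ℂ) hT) r
    rw [e, ← Algebra.smul_def]
    exact I.smul_mem r hx
  | id => rwa [cfcHom_id]
  | star_id => rwa [map_star, cfcHom_id]
  | add f g hf hg =>
    intro x hx
    rw [map_add, add_mul]
    exact I.add_mem (hf x hx) (hg x hx)
  | mul f g hf hg =>
    intro x hx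
    rw [map_mul, mul_assoc]
    exact hf _ (hg x hx)
  | frequently f hf =>
    intro x hx
    have hc : IsClosed {g : C(spectrum ℂ T, ℂ) | cfcHom (R := ℂ) hT g * x ∈ I} :=
      hI.preimage ((cfcHom_continuous hT).mul continuous_const)
    exact (hf.mono fun g hg => hg x hx).mem_of_closed hc

/-- A closed subspace invariant under right multiplication by a normal element and its adjoint is
invariant under right multiplication by every continuous function of that element. -/
theorem mul_cfcHom_mem (hT : IsStarNormal T) (hI : IsClosed (I : Set A))
    (h1 : ∀ x ∈ I, x * T ∈ I) (h2 : ∀ x ∈ I, x * star T ∈ I) (f : C(spectrum ℂ T, ℂ)) :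
    ∀ x ∈ I, x * cfcHom (R := ℂ) hT f ∈ I := by
  induction f using ContinuousMap.induction_on_of_compact with
  | const r =>
    intro x hx
    have e : cfcHom (R := ℂ) hT (ContinuousMap.const _ r) = algebraMap ℂ A r :=
      AlgHomClass.commutes (cfcHom (R := ℂ) hT) r
    rw [e, ← Algebra.commutes, ← Algebra.smul_def]
    exact I.smul_mem r hx
  | id => rwa [cfcHom_id]
  | star_id => rwa [map_star, cfcHom_id]
  | add f g hf hg =>
    intro x hx
    rw [map_add, mul_add]
    exact I.add_mem (hf x hx) (hg x hx)
  | mul f g hf hg =>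
    intro x hx
    rw [map_mul, ← mul_assoc]
    exact hg _ (hf x hx)
  | frequently f hf =>
    intro x hx
    have hc : IsClosed {g : C(spectrum ℂ T, ℂ) | x * cfcHom (R := ℂ) hT g ∈ I} :=
      hI.preimage (continuous_const.mul (cfcHom_continuous hT))
    exact (hf.mono fun g hg => hg x hx).mem_of_closed hc

/-- The ideal of continuous functions on the spectrum that send a normal element into a closed
subspace invariant under left multiplication by this element and its adjoint. -/
noncomputable def cfcIdeal (hT : IsStarNormal T) (hI : IsClosed (I : Set A))
    (h1 : ∀ x ∈ I, T * x ∈ I) (h2 : ∀ x ∈ I, star T * x ∈ I) : Ideal C(spectrum ℂ T, ℂ) where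
  carrier := {f | cfcHom (R := ℂ) hT f ∈ I}
  zero_mem' := by
    change cfcHom (R := ℂ) hT 0 ∈ I
    rw [map_zero]; exact I.zero_mem
  add_mem' {f g} hf hg := by
    change cfcHom (R := ℂ) hT (f + g) ∈ I
    rw [map_add]; exact I.add_mem hf hg
  smul_mem' f g hg := by
    change cfcHom (R := ℂ) hT (f * g) ∈ I
    rw [map_mul]; exact cfcHom_mul_mem hT hI h1 h2 f _ hg

theorem mem_cfcIdeal (hT : IsStarNormal T) (hI : IsClosed (I : Set A))
    (h1 : ∀ x ∈ I, T * x ∈ I) (h2 : ∀ x ∈ I, star T * x ∈ I) (f : C(spectrum ℂ T, ℂ)) :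
    f ∈ cfcIdeal hT hI h1 h2 ↔ cfcHom (R := ℂ) hT f ∈ I := Iff.rfl

/-- If `b - bc` lies in a closed subspace `I` with `Ic ⊆ I` and `‖c‖ < 1`, then `b` lies
in `I`. -/
theorem mem_of_sub_mul_mem (hI : IsClosed (I : Set A)) {b c : A} (hc : ‖c‖ < 1)
    (hIc : ∀ x ∈ I, x * c ∈ I) (hb : b - b * c ∈ I) : b ∈ I := by
  have h : ∀ n : ℕ, b - b * c ^ n ∈ I := by
    intro n
    induction n with
    | zero => simp
    | succ n ih =>
      -- Telescoping; the second summand stays in `I` because `Ic ⊆ I`.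
      have e : b - b * c ^ (n + 1) = (b - b * c) + (b - b * c ^ n) * c := by
        rw [pow_succ]; noncomm_ring
      rw [e]
      exact I.add_mem hb (hIc _ ih)
  have ht : Tendsto (fun n : ℕ => b - b * c ^ n) atTop (𝓝 (b - b * 0)) :=
    ((tendsto_pow_atTop_nhds_zero_of_norm_lt_one hc).const_mul b).const_sub b
  rw [mul_zero, sub_zero] at ht
  exact hI.mem_of_tendsto ht (Eventually.of_forall h)

/-- If `1 - z⁻¹T` is right invertible modulo `I` by an element normalizing `I`, then some function
of `T` in `I` does not vanish at `z`. -/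
theorem exists_mem_cfcIdeal_ne_zero (hT : IsStarNormal T) (hI : IsClosed (I : Set A))
    (h1 : ∀ x ∈ I, T * x ∈ I) (h2 : ∀ x ∈ I, star T * x ∈ I)
    (h3 : ∀ x ∈ I, ∀ f : C(spectrum ℂ T, ℂ), x * cfcHom (R := ℂ) hT f ∈ I) {R : A}
    (hR : ∀ x ∈ I, x * R ∈ I) (z : spectrum ℂ T) (hz : (z : ℂ) ≠ 0)
    (h : (1 - (z : ℂ)⁻¹ • T) * R - 1 ∈ I) :
    ∃ f ∈ cfcIdeal hT hI h1 h2, f z ≠ 0 := by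
  obtain ⟨δ, hδ, hδR⟩ : ∃ δ > 0, 2 * δ * ‖(z : ℂ)⁻¹‖ * ‖R‖ < 1 := by
    -- With `a = ‖z⁻¹‖‖R‖` the product becomes `a / (a + 1)`; the added `1` also covers `R = 0`.
    refine ⟨1 / (2 * (‖(z : ℂ)⁻¹‖ * ‖R‖ + 1)), by positivity, ?_⟩
    have : 0 ≤ ‖(z : ℂ)⁻¹‖ * ‖R‖ := by positivity
    rw [mul_one_div, div_mul_eq_mul_div, div_mul_eq_mul_div, div_lt_one (by positivity)]
    linarith
  -- Tent functions: `p r` vanishes at distance at least `rδ` from `z` and, for `r ≥ 1`, is `1`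
  -- within distance `(r - 1)δ`. Thus `p 2` is `1` wherever `p 1` is nonzero, and `p 1` is `1` at
  -- `z`.
  let p : ℝ → C(spectrum ℂ T, ℂ) := fun r =>
    ⟨fun w => ((max 0 (min 1 (r - dist w z / δ)) : ℝ) : ℂ), by fun_prop⟩
  let l : C(spectrum ℂ T, ℂ) := 1 - (z : ℂ)⁻¹ • ContinuousMap.restrict _ (.id ℂ)
  have hl : cfcHom (R := ℂ) hT l = 1 - (z : ℂ)⁻¹ • T := by
    rw [map_sub, map_one, map_smul, cfcHom_id]
  have hpp : p 1 * p 2 = p 1 := by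
    ext w
    change ((max 0 (min 1 (1 - dist w z / δ)) : ℝ) : ℂ) *
      ((max 0 (min 1 (2 - dist w z / δ)) : ℝ) : ℂ) = ((max 0 (min 1 (1 - dist w z / δ)) : ℝ) : ℂ)
    rcases le_total (dist w z / δ) 1 with hw | hw
    · rw [min_eq_left (by linarith : 1 ≤ 2 - dist w z / δ)]
      simp
    · rw [min_eq_right (by linarith [div_nonneg (dist_nonneg (x := w) (y := z)) hδ.le] :
        1 - dist w z / δ ≤ 1), max_eq_left (by linarith)]
      simp
  -- The function `l` vanishes at `z` and `|l(w)| = |z⁻¹||w - z|`, so it is small within `2δ` of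
  -- `z`, outside which `p 2` is zero.
  have hpl : ‖p 2 * l‖ ≤ 2 * δ * ‖(z : ℂ)⁻¹‖ := by
    refine (ContinuousMap.norm_le _ (by positivity)).2 fun w => ?_
    change ‖((max 0 (min 1 (2 - dist w z / δ)) : ℝ) : ℂ) * (1 - (z : ℂ)⁻¹ * (w : ℂ))‖ ≤ _
    have e : 1 - (z : ℂ)⁻¹ * (w : ℂ) = -((z : ℂ)⁻¹ * ((w : ℂ) - z)) := by
      rw [mul_sub, inv_mul_cancel₀ hz]; ring
    have e' : ‖(w : ℂ) - z‖ = dist w z := by rw [Subtype.dist_eq, dist_eq_norm]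
    rw [e, norm_mul, norm_neg, norm_mul, e', Complex.norm_real,
      Real.norm_of_nonneg (le_max_left _ _)]
    rcases le_total (dist w z / δ) 2 with hw | hw
    · have h4 : max 0 (min 1 (2 - dist w z / δ)) ≤ 1 := max_le zero_le_one (min_le_left _ _)
      have h5 : dist w z ≤ 2 * δ := (div_le_iff₀ hδ).1 hw
      calc _ ≤ 1 * (‖(z : ℂ)⁻¹‖ * (2 * δ)) := by gcongr
        _ = _ := by ring
    · rw [max_eq_left ((min_le_right _ _).trans (by linarith)), zero_mul]
      positivity
  let φ := cfcHom (R := ℂ) hT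
  refine ⟨p 1, ?_, by simp [p]⟩
  rw [mem_cfcIdeal]
  -- Modulo `I`, `p₁(T) ≡ p₁(T) l(T) R = p₁(T) (p₂l)(T) R` since `p₁p₂ = p₁`; the choice of `δ`
  -- makes `‖(p₂l)(T)R‖ < 1`.
  refine mem_of_sub_mul_mem hI (c := φ (p 2 * l) * R) ?_ (fun x hx => ?_) ?_
  · refine (norm_mul_le _ _).trans_lt (lt_of_le_of_lt ?_ hδR)
    rw [norm_cfcHom T]
    gcongr
  · rw [← mul_assoc]
    exact hR _ (h3 x hx _)
  · have e : φ (p 1) - φ (p 1) * (φ (p 2 * l) * R) = -(φ (p 1) * ((1 - (z : ℂ)⁻¹ • T) * R - 1)) := by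
      rw [← mul_assoc, ← map_mul, ← mul_assoc, hpp, map_mul, hl]
      noncomm_ring
    change φ (p 1) - φ (p 1) * (φ (p 2 * l) * R) ∈ I
    rw [e]
    exact I.neg_mem (cfcHom_mul_mem hT hI h1 h2 _ _ h)

/-- A continuous function on the spectrum sends `T` into a closed subspace `I` if for each `z`
with `f z ≠ 0` some function of `T` in `I` does not vanish at `z`. -/
theorem cfcHom_mem_of_forall_exists (hT : IsStarNormal T) (hI : IsClosed (I : Set A))
    (h1 : ∀ x ∈ I, T * x ∈ I) (h2 : ∀ x ∈ I, star T * x ∈ I) (f : C(spectrum ℂ T, ℂ))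
    (hf : ∀ z, f z ≠ 0 → ∃ g ∈ cfcIdeal hT hI h1 h2, g z ≠ 0) :
    cfcHom (R := ℂ) hT f ∈ I := by
  have hc : IsClosed (cfcIdeal hT hI h1 h2 : Set C(spectrum ℂ T, ℂ)) :=
    hI.preimage (cfcHom_continuous hT)
  -- A closed ideal of `C(K)` with `K` compact consists of all functions vanishing on its common
  -- zero set.
  rw [← mem_cfcIdeal hT hI h1 h2, ← ContinuousMap.idealOfSet_ofIdeal_isClosed hc,
    ContinuousMap.mem_idealOfSet]
  intro z hz
  by_contra h
  exact hz (ContinuousMap.mem_setOfIdeal.2 (hf z h))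

end FunctionalCalculus

/-- The extension by zero of a function in `C₀(K ∖ {0})` is continuous on `K`. -/
theorem continuousOn_extend_zeroAtInfty {K : Set ℂ} (η : C₀(↥(K \ {0}), ℂ)) :
    ContinuousOn (Function.extend Subtype.val η 0) K := by
  have he : ∀ z : ↥(K \ {0}), Function.extend Subtype.val η 0 (z : ℂ) = η z :=
    fun z => Subtype.val_injective.extend_apply _ _ z
  have hn : ∀ z : ℂ, z ∉ K \ {0} → Function.extend Subtype.val η 0 z = 0 := fun z hz =>
    Function.extend_apply' _ _ _ fun ⟨y, hy⟩ => hz (hy ▸ y.2)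
  intro z hz
  by_cases h0 : z = 0
  · subst h0
    rw [ContinuousWithinAt, hn 0 (by simp), Metric.tendsto_nhds]
    intro ε hε
    have h := (Metric.tendsto_nhds.1 η.zero_at_infty') ε hε
    rw [Filter.Eventually, mem_cocompact] at h
    obtain ⟨C, hC, hCε⟩ := h
    -- Outside the compact set `C ⊆ K ∖ {0}` the function is below `ε`. Its image is closed in `ℂ`
    -- and misses `0`, so its complement is the required neighbourhood of `0`.
    have hC' : IsClosed (Subtype.val '' C) := (hC.image continuous_subtype_val).isClosed
    have hmem : (Subtype.val '' C)ᶜ ∈ 𝓝 (0 : ℂ) := by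
      refine hC'.isOpen_compl.mem_nhds ?_
      rintro ⟨y, -, hy⟩
      exact y.2.2 hy
    refine mem_nhdsWithin_of_mem_nhds (mem_of_superset hmem fun w hw => ?_)
    change dist (Function.extend Subtype.val η 0 w) 0 < ε
    by_cases hw' : w ∈ K \ {0}
    · have h2 := he ⟨w, hw'⟩
      rw [h2]
      exact hCε fun hwC => hw ⟨_, hwC, rfl⟩
    · rw [hn w hw', dist_self]
      exact hε
  · have h1 : ContinuousOn (Function.extend Subtype.val η 0) (K \ {0}) := by
      rw [continuousOn_iff_continuous_domRestrict]
      refine η.continuous.congr fun w => (he w).symm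
    refine (h1 z ⟨hz, h0⟩).mono_of_mem_nhdsWithin ?_
    exact inter_mem_nhdsWithin K (isOpen_compl_singleton.mem_nhds h0)

/-! ### Cut-offs near the quasi-orbit -/

section Localization

variable {Γ B Ω : Type*} [CStarAlgebra B]

theorem norm_mulOp_le (f : lp (fun _ : Γ => B) ∞) : ‖mulOp f‖ ≤ ‖f‖ :=
  ContinuousLinearMap.opNorm_le_bound _ (norm_nonneg f) (norm_mulFun_le f)

theorem chi_apply (W : Set Γ) [DecidablePred (· ∈ W)] (ψ : EllTwo Γ B) (x : Γ) :
    chi B W ψ x = if x ∈ W then ψ x else 0 := by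
  change W.indicator (fun _ => (1 : B)) x * ψ x = _
  by_cases h : x ∈ W <;> simp [h]

theorem norm_chi_le_one (W : Set Γ) : ‖chi B W‖ ≤ 1 := by
  classical
  refine ContinuousLinearMap.opNorm_le_bound _ zero_le_one fun ψ => ?_
  rw [one_mul]
  refine EllTwo.norm_le_of_finNorm_le fun F => le_trans ?_ (EllTwo.finNorm_le_norm F ψ)
  have h := norm_sum_le_of_le F (a := fun x => star (chi B W ψ x) * chi B W ψ x) (b := ψ) 1
    (fun x => ?_) zero_le_one
  · rw [one_mul] at h
    exact h
  · by_cases hx : x ∈ W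
    -- `‖1‖ = 1` holds only for `B ≠ 0`; the zero algebra is treated apart.
    · rcases subsingleton_or_nontrivial B with hB | hB
      · exact ⟨0, Subsingleton.elim _ _, by simp⟩
      · exact ⟨1, by simp [chi_apply, hx], by simp⟩
    · exact ⟨0, by simp [chi_apply, hx], by simp⟩

theorem chi_mul_chi_of_subset {V W : Set Γ} (h : V ⊆ W) : chi B V * chi B W = chi B V := by
  classical
  refine EndB.ext fun ψ => EllTwo.ext fun x => ?_
  rw [EndB.mul_apply, chi_apply, chi_apply, chi_apply]
  by_cases hx : x ∈ V
  · simp [hx, h hx]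
  · simp [hx]

theorem norm_chi_mul_le (W : Set Γ) (D : EndB Γ B) : ‖chi B W * D‖ ≤ ‖D‖ :=
  (norm_mul_le _ _).trans (mul_le_of_le_one_left (norm_nonneg D) (norm_chi_le_one W))

/-- Since `χ_V = χ_V χ_W` and `‖χ_V‖ ≤ 1`. This allows neighbourhoods of `Ξ` to be shrunk, in
particular intersected. -/
theorem norm_chi_mul_mono {V W : Set Γ} (h : V ⊆ W) (D : EndB Γ B) :
    ‖chi B V * D‖ ≤ ‖chi B W * D‖ := by
  rw [← chi_mul_chi_of_subset h, mul_assoc]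
  exact norm_chi_mul_le _ _

variable [CommGroup Γ]

theorem norm_shiftOp_le (g : Γ) : ‖shiftOp B g‖ ≤ 1 :=
  ContinuousLinearMap.opNorm_le_bound _ zero_le_one fun ψ => by
    rw [one_mul]; exact (norm_shiftFun g ψ).le

/-- Moving the cut-off past `S_g` translates it to `g⁻¹W` and brings it next to the multiplication
operator of a generator `S_g f`. -/
theorem chi_mul_shiftOp (W : Set Γ) (g : Γ) :
    chi B W * shiftOp B g = shiftOp B g * chi B ((g * ·) ⁻¹' W) := by
  classical
  refine EndB.ext fun ψ => EllTwo.ext fun x => ?_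
  rw [EndB.mul_apply, EndB.mul_apply, chi_apply, shiftOp_apply, shiftOp_apply, chi_apply]
  simp

variable [TopologicalSpace Ω] {β : Γ →* (B ≃⋆ₐ[ℂ] B)} {ι : Γ → Ω}

/-- The twist by `β_x⁻¹` does not increase norms, so a pointwise bound on `f` over `W` passes to the
operator. -/
theorem norm_chi_mul_funOp_le (W : Set Γ) (f : C₀(Ω, B)) {C : ℝ} (hC : 0 ≤ C)
    (h : ∀ x ∈ W, ‖f (ι x)‖ ≤ C) : ‖chi B W * funOp β ι f‖ ≤ C := by
  classical
  refine ContinuousLinearMap.opNorm_le_bound _ hC fun ψ => ?_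
  refine EllTwo.norm_le_of_finNorm_le fun F =>
    le_trans ?_ (mul_le_mul_of_nonneg_left (EllTwo.finNorm_le_norm F ψ) hC)
  refine norm_sum_le_of_le F (a := fun x => star ((chi B W * funOp β ι f) ψ x) *
    (chi B W * funOp β ι f) ψ x) (b := ψ) C (fun x => ?_) hC
  by_cases hx : x ∈ W
  · refine ⟨(β x).symm (f (ι x)), ?_, (NonUnitalStarAlgHom.norm_apply_le _ _).trans (h x hx)⟩
    simp only [EndB.mul_apply, chi_apply, hx, if_true, funOp_apply]
  · exact ⟨0, by simp [chi_apply, hx], by simpa using hC⟩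

variable [MulAction Γ Ω] [ContinuousConstSMul Γ Ω]

/-- Elements of the ideal of the quasi-orbit are small near the quasi-orbit. -/
theorem exists_isOpen_norm_chi_mul_le (hι : ∀ g x : Γ, ι (g * x) = g • ι x) {ω : Ω}
    {D : EndB Γ B} (hD : D ∈ idealSpace β ι ω) {ε : ℝ} (hε : 0 < ε) :
    ∃ V : Set Ω, IsOpen V ∧ quasiOrbit Γ ω ⊆ V ∧ ‖chi B (ι ⁻¹' V) * D‖ ≤ ε := by
  have key : ∀ D ∈ Submodule.span ℂ (generators β ι (vanishingOn Γ B ω)), ∀ ε > 0,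
      ∃ V : Set Ω, IsOpen V ∧ quasiOrbit Γ ω ⊆ V ∧ ‖chi B (ι ⁻¹' V) * D‖ ≤ ε := by
    intro D hD
    induction hD using Submodule.span_induction with
    | mem D hD =>
      obtain ⟨g, f, hf, rfl⟩ := hD
      intro ε hε
      -- The translate by `g⁻¹` anticipates the commutation with `S_g`: after it, the cut-off is to
      -- the points `x` of `Γ` with `‖f(x)‖ < ε`.
      refine ⟨{x | ‖f (g⁻¹ • x)‖ < ε}, ?_, fun ξ hξ => ?_, ?_⟩
      · exact isOpen_lt (f.continuous.comp (continuous_const_smul g⁻¹)).norm continuous_const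
      · change ‖f (g⁻¹ • ξ)‖ < ε
        rw [hf _ (smul_mem_quasiOrbit hξ _), norm_zero]
        exact hε
      · rw [← mul_assoc, chi_mul_shiftOp, mul_assoc]
        refine (norm_mul_le _ _).trans
          ((mul_le_of_le_one_left (norm_nonneg _) (norm_shiftOp_le g)).trans ?_)
        refine norm_chi_mul_funOp_le _ f hε.le fun x hx => ?_
        have hx' : ‖f (g⁻¹ • ι (g * x))‖ < ε := hx
        rw [hι, inv_smul_smul] at hx'
        exact hx'.le
    | zero => exact fun ε hε => ⟨Set.univ, isOpen_univ, Set.subset_univ _, by simpa using hε.le⟩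
    | add D D' _ _ h h' =>
      intro ε hε
      obtain ⟨V, hV, hΞ, hD⟩ := h (ε / 2) (by positivity)
      obtain ⟨V', hV', hΞ', hD'⟩ := h' (ε / 2) (by positivity)
      refine ⟨V ∩ V', hV.inter hV', Set.subset_inter hΞ hΞ', ?_⟩
      rw [mul_add]
      refine (norm_add_le _ _).trans ?_
      have h1 := norm_chi_mul_mono (Set.preimage_mono (f := ι) (Set.inter_subset_left : V ∩ V' ⊆ V)) D
      have h2 :=
        norm_chi_mul_mono (Set.preimage_mono (f := ι) (Set.inter_subset_right : V ∩ V' ⊆ V')) D'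
      linarith
    | smul c D _ h =>
      intro ε hε
      obtain ⟨V, hV, hΞ, hD⟩ := h (ε / (‖c‖ + 1)) (by positivity)
      refine ⟨V, hV, hΞ, ?_⟩
      rw [mul_smul_comm, norm_smul]
      rw [le_div_iff₀ (by positivity)] at hD
      nlinarith [norm_nonneg (chi B (ι ⁻¹' V) * D)]
  -- The error `D - D'` stays below `ε / 2` under any cut-off, so the neighbourhood found for the
  -- finite sum `D'` also serves `D`.
  obtain ⟨D', hD', hdist⟩ := Metric.mem_closure_iff.1 hD (ε / 2) (by positivity)
  obtain ⟨V, hV, hΞ, hD''⟩ := key D' hD' (ε / 2) (by positivity)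
  refine ⟨V, hV, hΞ, ?_⟩
  have e : chi B (ι ⁻¹' V) * D = chi B (ι ⁻¹' V) * (D - D') + chi B (ι ⁻¹' V) * D' := by
    rw [← mul_add, sub_add_cancel]
  rw [e]
  refine (norm_add_le _ _).trans ?_
  have h1 := norm_chi_mul_le (ι ⁻¹' V) (D - D')
  rw [dist_eq_norm] at hdist
  linarith

/-- A function of a normal element of the crossed product supported away from the quasispectrum of
its image in the bulk algebra lies in the ideal of the quasi-orbit. -/
theorem evalAt_mem_idealSpace (hι : ∀ g x : Γ, ι (g * x) = g • ι x) {ω : Ω} {T : EndB Γ B}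
    (hT : T ∈ crossedProduct β ι hι) (hT_normal : IsStarNormal T)
    (η : C₀(↥(spectrum ℂ T \ {0}), ℂ))
    (hη : ∀ z ∈ tsupport η, (z : ℂ) ∉ quasispectrum ℂ (bulkMap β hι ω ⟨T, hT⟩)) :
    evalAt T η ∈ idealSpace β ι ω := by
  have hI : IsClosed (idealSpace β ι ω : Set (EndB Γ B)) := Submodule.isClosed_topologicalClosure _
  have hTs : star T ∈ crossedProduct β ι hι := star_mem hT
  have h1 : ∀ x ∈ idealSpace β ι ω, T * x ∈ idealSpace β ι ω := fun x hx =>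
    mul_mem_idealSpace hι hT hx
  have h2 : ∀ x ∈ idealSpace β ι ω, star T * x ∈ idealSpace β ι ω := fun x hx =>
    mul_mem_idealSpace hι hTs hx
  have h3 : ∀ x ∈ idealSpace β ι ω, ∀ f : C(spectrum ℂ T, ℂ),
      x * cfcHom (R := ℂ) hT_normal f ∈ idealSpace β ι ω :=
    fun x hx f => mul_cfcHom_mem hT_normal hI (fun y hy => idealSpace_mul_mem hι hy hT)
      (fun y hy => idealSpace_mul_mem hι hy hTs) f x hx
  rw [evalAt, cfc_apply _ T hT_normal (continuousOn_extend_zeroAtInfty η)]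
  refine cfcHom_mem_of_forall_exists hT_normal hI h1 h2 _ fun z hz => ?_
  change Function.extend Subtype.val η 0 (z : ℂ) ≠ 0 at hz
  have hz0 : (z : ℂ) ∈ spectrum ℂ T \ {0} := by
    by_contra h
    exact hz (Function.extend_apply' _ _ _ fun ⟨y, hy⟩ => h (hy ▸ y.2))
  have hzη : (⟨z, hz0⟩ : ↥(spectrum ℂ T \ {0})) ∈ tsupport η := by
    refine subset_tsupport _ ?_
    have := Subtype.val_injective.extend_apply η 0 (⟨z, hz0⟩ : ↥(spectrum ℂ T \ {0}))
    rwa [Function.mem_support, ← this]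
  have hq := hη _ hzη
  have hz0' : (z : ℂ) ≠ 0 := hz0.2
  -- Quasi-invertibility of `X = -z⁻¹q(T)` gives `y + X + Xy = 0`, that is `(1 + X)(1 + y) = 1` in
  -- the unitization. A lift `R` of `y` makes `1 + R` a right inverse of `1 - z⁻¹T` modulo the
  -- ideal.
  obtain ⟨R, hR, hmem⟩ : ∃ R ∈ crossedProduct β ι hι,
      R + -((z : ℂ)⁻¹ • T) + -((z : ℂ)⁻¹ • T) * R ∈ idealSpace β ι ω := by
    rw [quasispectrum.mem_iff_of_isUnit hz0'.isUnit, not_not, isQuasiregular_iff] at hq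
    obtain ⟨y, hy, -⟩ := hq
    rw [Units.smul_def, Units.val_inv_eq_inv_val, IsUnit.unit_spec] at hy
    obtain ⟨⟨R, hR⟩, rfl⟩ := Quotient.exists_rep y
    refine ⟨R, hR, ?_⟩
    let X : crossedProduct β ι hι := -((z : ℂ)⁻¹ • ⟨T, hT⟩)
    have h4 : bulkMap β hι ω (⟨R, hR⟩ + X + X * ⟨R, hR⟩) = bulkMap β hι ω 0 := hy
    have h5 := (TwoSidedIdeal.rel_iff _ _ _).1 ((RingCon.eq _).1 h4)
    rw [sub_zero, mem_bulkIdeal] at h5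
    exact h5
  refine exists_mem_cfcIdeal_ne_zero hT_normal hI h1 h2 h3 (R := 1 + R) (fun x hx => ?_) z hz0' ?_
  · rw [mul_add, mul_one]
    exact add_mem hx (idealSpace_mul_mem hι hx hR)
  · have e : (1 - (z : ℂ)⁻¹ • T) * (1 + R) - 1
        = R + -((z : ℂ)⁻¹ • T) + -((z : ℂ)⁻¹ • T) * R := by noncomm_ring
    rwa [e]

end Localization

/-- By commutation `XUD = XDU`, and `‖U‖ ≤ 1`; the bound is therefore uniform in `U`. -/
theorem norm_mul_mul_apply_le {Γ B : Type*} [CStarAlgebra B] {X D U : EndB Γ B} {ε : ℝ}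
    (h : ‖X * D‖ ≤ ε) (hU : U ∈ unitary (EndB Γ B)) (hc : Commute U D) (ψ : EllTwo Γ B) :
    ‖(X * U * D) ψ‖ ≤ ε * ‖ψ‖ := by
  have hU1 : ‖U‖ ≤ 1 := by
    rcases subsingleton_or_nontrivial (EndB Γ B) with hs | hs
    · rw [Subsingleton.elim U 0, norm_zero]
      exact zero_le_one
    · exact (CStarRing.norm_of_mem_unitary hU).le
  refine (EndB.le_opNorm _ ψ).trans (mul_le_mul_of_nonneg_right ?_ (norm_nonneg ψ))
  rw [mul_assoc, hc.eq, ← mul_assoc]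
  exact (norm_mul_le _ _).trans ((mul_le_of_le_one_right (norm_nonneg _) hU1).trans h)

end Interface

/-! ### The proposition -/

open Interface
theorem mainTheorem3 {Γ B Ω : Type*}
    [CommGroup Γ] [TopologicalSpace Γ] [DiscreteTopology Γ] [CStarAlgebra B]
    (β : Γ →* (B ≃⋆ₐ[ℂ] B))
    [TopologicalSpace Ω] [T2Space Ω] [LocallyCompactSpace Ω]
    [MulAction Γ Ω] [ContinuousConstSMul Γ Ω]
    (ι : Γ → Ω) (hι_emb : Topology.IsOpenEmbedding ι) (hι_dense : DenseRange ι)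
    (hι : ∀ g x : Γ, ι (g * x) = g • ι x)
    (ω : Ω) (hω : ω ∉ Set.range ι)
    (T : EndB Γ B) (hT : T ∈ crossedProduct β ι hι) (hT_normal : IsStarNormal T)
    (η : C₀(↥(spectrum ℂ T \ {0}), ℂ))
    (hη : ∀ z ∈ tsupport η, (z : ℂ) ∉ quasispectrum ℂ (bulkMap β hι ω ⟨T, hT⟩))
    (ε : ℝ) (hε : 0 < ε) :
    ∃ V : Set Ω, IsOpen V ∧ quasiOrbit Γ ω ⊆ V ∧
      ‖chi B (ι ⁻¹' V) * evalAt T η‖ ≤ ε ∧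
      (∀ hU : T ∈ unitary (EndB Γ B), ∀ (n : ℤ) (ψ : EllTwo Γ B),
        ‖(chi B (ι ⁻¹' V) * (((⟨T, hU⟩ : unitary (EndB Γ B)) ^ n : unitary (EndB Γ B)) : EndB Γ B)
            * evalAt T η) ψ‖ ≤ ε * ‖ψ‖) ∧
      (IsSelfAdjoint T → ∀ (t : ℝ) (ψ : EllTwo Γ B),
        ‖(chi B (ι ⁻¹' V) * NormedSpace.exp ((-(Complex.I * (t : ℂ))) • T)
            * evalAt T η) ψ‖ ≤ ε * ‖ψ‖) := by
  obtain ⟨V, hV, hΞ, h⟩ :=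
    exists_isOpen_norm_chi_mul_le hι (evalAt_mem_idealSpace hι hT hT_normal η hη) hε
  have hc : Commute T (evalAt T η) := by
    have h' := cfc_commute_cfc (id : ℂ → ℂ) (Function.extend Subtype.val η 0) T
    rwa [cfc_id ℂ T] at h'
  refine ⟨V, hV, hΞ, h, fun hU n ψ => ?_, fun hH t ψ => ?_⟩
  · refine norm_mul_mul_apply_le h (Subtype.mem _) ?_ ψ
    have h' : Commute ((Unitary.toUnits ⟨T, hU⟩ : (EndB Γ B)ˣ) : EndB Γ B) (evalAt T η) := hc
    have h'' := h'.units_zpow_left n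
    rw [← map_zpow] at h''
    exact h''
  · let _ := NormedAlgebra.restrictScalars ℚ ℂ (EndB Γ B)
    refine norm_mul_mul_apply_le h ?_ (hc.smul_left _).exp_left ψ
    refine NormedSpace.exp_mem_unitary_of_mem_skewAdjoint ?_
    -- For self-adjoint `T` and real `t` the exponent `-itT` is skew-adjoint, so its exponential is
    -- unitary.
    rw [skewAdjoint.mem_iff, star_smul, hH.star_eq, ← neg_smul]
    congr 1
    simp
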